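/- Let $\mathcal{T}$ be a finite mesh of convex polyhedra in $\mathbb{R}^3$: finitely many three-dimensional convex polytopes, any two distinct ones of which intersect in a (possibly empty) common face of both. Let $\mathbf v_1,\dots,\mathbf v_p$ be an enumeration without repetition of all vertices of the mesh, and let $\Omega$ be the interior of $\bigcup_{\mathfrak m\in\mathcal T}\mathfrak m$. For each $\mathfrak m\in\mathcal T$ let $\{\lambda_i^{\mathfrak m} : \mathbf v_i\in\mathfrak m\}$ be generalized barycentric coordinates on $\mathfrak m$, that is, functions $\lambda_i^{\mathfrak m}\ge 0$ on $\mathfrak m$ with $$L(\mathbf x)=\sum_{i:\,\mathbf v_i\in\mathfrak m}L(\mathbf v_i)\,\lambda_i^{\mathfrak m}(\mathbf x)\qquad\text{for all }\mathbf x\in\mathfrak m\text{ and every affine } L:\mathbb R^3\to\mathbb R .$$ Assume that every $\lambda_i^{\mathfrak m}$ is Lipschitz continuous on $\mathfrak m$, and that the coordinates agree on shared faces: $\lambda_i^{\mathfrak m}=\lambda_i^{\mathfrak m'}$ on $\mathfrak m\cap\mathfrak m'$ whenever $\mathbf v_i\in\mathfrak m\cap\mathfrak m'$. Let $\hat\lambda_i$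 be the hat function given on each $\mathfrak m\in\mathcal T$ by $\hat\lambda_i=\lambda_i^{\mathfrak m}$ if $\mathbf v_i\in\mathfrak m$ and $\hat\lambda_i=0$ if $\mathbf v_i\notin\mathfrak m$; its gradient exists almost everywhere in $\Omega$. If $$\mathbf u\in\operatorname{span}\bigl\{\hat\lambda_i\,\nabla\hat\lambda_j\times\nabla\hat\lambda_k \;:\; \exists\,\mathfrak m\in\mathcal T\text{ such that }\mathbf v_i,\mathbf v_j,\mathbf v_k\in\mathfrak m\bigr\},$$ then $\mathbf u\in H(\mathrm{div},\mathcal T)$: that is, $\mathbf u\in L^2(\Omega)^3$ and there is $d\in L^2(\Omega)$ with $\int_\Omega \mathbf u\cdot\nabla\varphi\,d\mathbf x=-\int_\Omega d\,\varphi\,d\mathbf x$ for all $\varphi\in C_c^\infty(\Omega)$. -/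

import Mathlib

open scoped ContDiff

/-- Euclidean three-space. -/
abbrev E3 : Type := EuclideanSpace ℝ (Fin 3)

/-- The cross product of two vectors of `ℝ³`. -/
noncomputable def cross3 (a b : E3) : E3 :=
  WithLp.toLp 2 (crossProduct (WithLp.ofLp a) (WithLp.ofLp b))

/-- A finite mesh of convex polyhedra in `ℝ³`: finitely many three-dimensional convex polytopes, any
two of which meet in a common (possibly empty) face. Stating `inter_face` for all ordered pairs
makes `m ∩ m'` a face of `m` and a face of `m'`. -/
structure PolyhedralMesh where
  cells : Set (Set E3)
  finite_cells : cells.Finite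
  polytope : ∀ m ∈ cells, ∃ s : Finset E3, m = convexHull ℝ (s : Set E3)
  nonempty_interior : ∀ m ∈ cells, (interior m).Nonempty
  inter_face : ∀ m ∈ cells, ∀ m' ∈ cells, m ≠ m' → IsExposed ℝ m (m ∩ m')

namespace PolyhedralMesh

/-- The set of all vertices of the elements of the mesh. -/
def vertices (M : PolyhedralMesh) : Set E3 := ⋃ m ∈ M.cells, m.extremePoints ℝ

/-- The open domain covered by the mesh. -/
def domain (M : PolyhedralMesh) : Set E3 := interior (⋃ m ∈ M.cells, m)

/-- A vertex of the mesh that lies in a cell is a vertex of that cell. -/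
theorem mem_extremePoints (M : PolyhedralMesh) {m : Set E3} (hm : m ∈ M.cells) {w : E3}
    (hw : w ∈ M.vertices) (hwm : w ∈ m) : w ∈ m.extremePoints ℝ := by
  simp only [vertices, Set.mem_iUnion] at hw
  obtain ⟨m', hm', hw'⟩ := hw
  by_cases h : m = m'
  · rwa [h]
  · have h1 := (M.inter_face m hm m' hm' h).isExtreme
    refine h1.extremePoints_subset_extremePoints ?_
    exact inter_extremePoints_subset_extremePoints_of_subset Set.inter_subset_right
      ⟨⟨hwm, hw'.1⟩, hw'⟩

end PolyhedralMesh

/-- Generalized barycentric coordinates on a convex polytope `m`: the family `v` lists the vertices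
of `m`, each once, and the functions `lam i` are non-negative on `m` and satisfy
`L = ∑ i, L (v i) * lam i` on `m` for every linear (affine) function `L`. The sum `∑ᶠ` runs over a
finite type. -/
structure IsGBC {ι : Type*} [Finite ι] (m : Set E3) (v : ι → E3) (lam : ι → E3 → ℝ) : Prop where
  injective : Function.Injective v
  range_eq : Set.range v = m.extremePoints ℝ
  nonneg : ∀ i, ∀ x ∈ m, 0 ≤ lam i x
  reproduces : ∀ L : E3 →ᵃ[ℝ] ℝ, ∀ x ∈ m, L x = ∑ᶠ i, L (v i) * lam i x

open Classical in
/-- The hat function attached to the `i`-th mesh vertex by coordinates `lam m` given on each cell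
`m`: at `x` it is `lam m i x` for a cell `m` containing `x` and `v i`, and `0` if no cell contains
both. See `hatFun_eq` and `hatFun_eq_zero` for the independence of the chosen cell. -/
noncomputable def hatFun (M : PolyhedralMesh) {p : ℕ} (v : Fin p → E3)
    (lam : Set E3 → Fin p → E3 → ℝ) (i : Fin p) (x : E3) : ℝ :=
  if h : ∃ m ∈ M.cells, x ∈ m ∧ v i ∈ m then lam h.choose i x else 0

/-- If the coordinates of different cells agree on shared faces, the hat function equals `lam m i`
on every cell `m` having `v i` as a vertex. -/
theorem hatFun_eq (M : PolyhedralMesh) {p : ℕ} (v : Fin p → E3) (lam : Set E3 → Fin p → E3 → ℝ)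
    (hagree : ∀ m ∈ M.cells, ∀ m' ∈ M.cells, ∀ i, v i ∈ m → v i ∈ m' →
      Set.EqOn (lam m i) (lam m' i) (m ∩ m'))
    {m : Set E3} (hm : m ∈ M.cells) {i : Fin p} (hi : v i ∈ m) {x : E3} (hx : x ∈ m) :
    hatFun M v lam i x = lam m i x := by
  have h : ∃ m ∈ M.cells, x ∈ m ∧ v i ∈ m := ⟨m, hm, hx, hi⟩
  rw [hatFun, dif_pos h]
  exact hagree _ h.choose_spec.1 m hm i h.choose_spec.2.2 hi ⟨h.choose_spec.2.1, hx⟩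

/-- The hat function vanishes on every cell that does not contain its vertex. -/
theorem hatFun_eq_zero (M : PolyhedralMesh) {p : ℕ} (v : Fin p → E3)
    (lam : Set E3 → Fin p → E3 → ℝ)
    (hgbc : ∀ m ∈ M.cells,
      IsGBC m (fun i : {i : Fin p // v i ∈ m} => v i) (fun i => lam m i))
    {m : Set E3} (hm : m ∈ M.cells) {i : Fin p} (hi : v i ∉ m) {x : E3} (hx : x ∈ m) :
    hatFun M v lam i x = 0 := by
  rw [hatFun]
  split_ifs with h
  swap
  · rfl
  obtain ⟨hc, hxc, hic⟩ := h.choose_spec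
  generalize h.choose = c at hc hxc hic
  have hne : c ≠ m := fun e => hi (e ▸ hic)
  obtain ⟨l, hl⟩ := M.inter_face c hc m hm hne ⟨x, hxc, hx⟩
  have hxF : x ∈ c ∩ m := ⟨hxc, hx⟩
  rw [hl] at hxF
  have G := hgbc c hc
  have := Fintype.ofFinite {i : Fin p // v i ∈ c}
  have e1 := G.reproduces (AffineMap.const ℝ E3 (l x)) x hxc
  have e2 := G.reproduces l.toLinearMap.toAffineMap x hxc
  rw [finsum_eq_sum_of_fintype] at e1 e2
  simp only [AffineMap.const_apply, LinearMap.coe_toAffineMap, ContinuousLinearMap.coe_coe]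
    at e1 e2
  have e3 : ∑ j : {i : Fin p // v i ∈ c}, (l x - l (v j)) * lam c j x = 0 := by
    simp only [sub_mul, Finset.sum_sub_distrib]
    linarith
  have hnn : ∀ j ∈ (Finset.univ : Finset {i : Fin p // v i ∈ c}),
      0 ≤ (l x - l (v j)) * lam c j x := fun j _ =>
    mul_nonneg (sub_nonneg.2 (hxF.2 _ j.2)) (G.nonneg j x hxc)
  have e4 := (Finset.sum_eq_zero_iff_of_nonneg hnn).1 e3 ⟨i, hic⟩ (Finset.mem_univ _)
  rcases mul_eq_zero.1 e4 with h0 | h0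
  · exfalso
    have hF : v i ∈ c ∩ m := by
      rw [hl]
      refine ⟨hic, fun y hy => (hxF.2 y hy).trans ?_⟩
      simp only at h0
      linarith
    exact hi hF.2
  · exact h0

/-- The vector field `λ̂ᵢ ∇λ̂ⱼ × ∇λ̂ₖ`. -/
noncomputable def hatField (M : PolyhedralMesh) {p : ℕ} (v : Fin p → E3)
    (lam : Set E3 → Fin p → E3 → ℝ) (i j k : Fin p) (x : E3) : E3 :=
  hatFun M v lam i x •
    cross3 (gradient (hatFun M v lam j) x) (gradient (hatFun M v lam k) x)

/-- `d` is a weak (distributional) divergence of `u` on the open set `Ω`. -/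
def HasWeakDiv (Ω : Set E3) (u : E3 → E3) (d : E3 → ℝ) : Prop :=
  ∀ φ : E3 → ℝ, ContDiff ℝ ∞ φ → HasCompactSupport φ → tsupport φ ⊆ Ω →
    ∫ x in Ω, inner ℝ (u x) (gradient φ x) = -∫ x in Ω, d x * φ x

/-- The space `H(div, Ω)` of square-integrable vector fields with square-integrable weak
divergence. -/
def HdivSpace (Ω : Set E3) : Set (E3 → E3) :=
  {u | MeasureTheory.MemLp u 2 (MeasureTheory.volume.restrict Ω) ∧
    ∃ d : E3 → ℝ, MeasureTheory.MemLp d 2 (MeasureTheory.volume.restrict Ω) ∧ HasWeakDiv Ω u d}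

/-!
The field `a ∇b × ∇c` has weak divergence `∇a · (∇b × ∇c)` as soon as `a`, `b`, `c` are locally
Lipschitz. Hat functions are bounded and locally Lipschitz on the mesh domain with a uniform
constant, so both the field and its divergence are bounded on a domain of finite volume.

The regularity of the hat functions uses little of the mesh: they are well defined and Lipschitz on
each of finitely many closed cells, and a point of the domain has a neighbourhood that meets only
the cells containing it (`uniformlyLocallyLipschitzOn_of_finite_closed_cover`). No traces on the
faces or outer normals are needed.

The divergence formula amounts to `∫ (∇b × ∇c) · ∇(φ a) = 0` for every test function `φ`. On a
compact neighbourhood of the support of `φ` the three functions may be replaced by globally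
Lipschitz ones. If `a` and `c` are smooth, the integrand is `∇b · (∇c × ∇(φ a))`, a Lipschitz
gradient tested with a smooth divergence-free field, and integration by parts gives zero
(`LipschitzWith.integral_triple_eq_zero_of_contDiff`). In general `a` and `c` are mollified: the
derivatives of the mollifications stay bounded by the Lipschitz constant and converge almost
everywhere (`LipschitzWith.exists_smooth_approx`), by Rademacher's theorem and Lebesgue
differentiation, so dominated convergence applies (`LipschitzWith.integral_triple_eq_zero`).
-/

section

open MeasureTheory Set Filter Topology
open scoped Convolution

/-! ### Mollification of Lipschitz functions -/

section Mollification

variable {E : Type*} [NormedAddCommGroup E] [NormedSpace ℝ E] [FiniteDimensional ℝ E]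
  [MeasurableSpace E] [BorelSpace E] {μ : Measure E} [μ.IsAddHaarMeasure]

theorem LipschitzWith.locallyIntegrable_fderiv {K : NNReal} {a : E → ℝ}
    (ha : LipschitzWith K a) : LocallyIntegrable (fderiv ℝ a) μ :=
  (memLp_top_of_bound (measurable_fderiv ℝ a).aestronglyMeasurable (K : ℝ)
    (.of_forall fun _ => norm_fderiv_le_of_lipschitz ℝ ha)).locallyIntegrable le_top

/-- Convolution with a continuous compactly supported kernel moves the derivative onto a Lipschitz
function: by Rademacher's theorem one may differentiate under the integral sign. -/
theorem LipschitzWith.hasFDerivAt_convolution_right {K : NNReal} {a ρ : E → ℝ}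
    (ha : LipschitzWith K a) (hρ : Continuous ρ) (hρc : HasCompactSupport ρ) (x : E) :
    HasFDerivAt (ρ ⋆[ContinuousLinearMap.lsmul ℝ ℝ, μ] a)
      ((ρ ⋆[ContinuousLinearMap.lsmul ℝ ℝ, μ] fderiv ℝ a) x) x := by
  have hρi : Integrable ρ μ := hρ.integrable_of_hasCompactSupport hρc
  refine (hasFDerivAt_integral_of_dominated_loc_of_lip (μ := μ) (𝕜 := ℝ)
    (F := fun y t => ρ t • a (y - t)) (F' := fun t => ρ t • fderiv ℝ a (x - t))
    (bound := fun t => |ρ t| * K) (s := univ) (x₀ := x) univ_mem ?_ ?_ ?_ ?_ ?_ ?_).2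
  · exact .of_forall fun y =>
      (hρ.smul (ha.continuous.comp (continuous_const.sub continuous_id))).aestronglyMeasurable
  · exact (hρ.smul (ha.continuous.comp
      (continuous_const.sub continuous_id))).integrable_of_hasCompactSupport hρc.smul_right
  · exact hρ.aestronglyMeasurable.smul
      ((measurable_fderiv ℝ a).comp (measurable_const.sub measurable_id)).aestronglyMeasurable
  · refine .of_forall fun t => LipschitzOnWith.of_dist_le_mul fun y _ z _ => ?_
    have h := ha.dist_le_mul (y - t) (z - t)
    rw [dist_sub_right] at h
    simp only [smul_eq_mul, Real.dist_eq, ← mul_sub, abs_mul, Real.coe_nnabs, abs_abs,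
      NNReal.abs_eq] at h ⊢
    rw [mul_assoc]
    exact mul_le_mul_of_nonneg_left h (abs_nonneg _)
  · exact hρi.abs.mul_const _
  · have h := (quasiMeasurePreserving_sub_left_of_right_invariant μ x).ae
      (ha.ae_differentiableAt (μ := μ))
    filter_upwards [h] with t ht
    have h2 : HasFDerivAt (fun y => a (y - t)) (fderiv ℝ a (x - t)) x := by
      exact (hasFDerivAt_comp_sub t).2 ht.hasFDerivAt
    exact h2.const_smul (ρ t)

/-- A Lipschitz function is the limit of smooth functions with the same Lipschitz constant, at
distance at most that constant, whose derivatives converge almost everywhere. -/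
theorem LipschitzWith.exists_smooth_approx {K : NNReal} {a : E → ℝ} (ha : LipschitzWith K a) :
    ∃ A : ℕ → E → ℝ, (∀ n, ContDiff ℝ ∞ (A n)) ∧ (∀ n x, ‖fderiv ℝ (A n) x‖ ≤ K) ∧
      (∀ n x, |A n x - a x| ≤ K) ∧ (∀ x, Tendsto (A · x) atTop (𝓝 (a x))) ∧
      ∀ᵐ x ∂μ, Tendsto (fun n => fderiv ℝ (A n) x) atTop (𝓝 (fderiv ℝ a x)) := by
  -- Lebesgue differentiation needs a bounded ratio of the outer radius to the inner one.
  let ρ : ℕ → ContDiffBump (0 : E) := fun n =>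
    ⟨1 / ((n : ℝ) + 1) / 2, 1 / ((n : ℝ) + 1), by positivity, half_lt_self (by positivity)⟩
  have hout : Tendsto (fun n => (ρ n).rOut) atTop (𝓝 0) := tendsto_one_div_add_atTop_nhds_zero_nat
  have hle (n) : (ρ n).rOut ≤ 1 := by
    change 1 / ((n : ℝ) + 1) ≤ 1
    rw [div_le_one (by positivity)]
    linarith [n.cast_nonneg (α := ℝ)]
  have hfd (n x) := ha.hasFDerivAt_convolution_right (μ := μ)
    ((ρ n).continuous_normed (μ := μ)) (ρ n).hasCompactSupport_normed x
  refine ⟨fun n => (ρ n).normed μ ⋆[ContinuousLinearMap.lsmul ℝ ℝ, μ] a, fun n => ?_,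
    fun n x => ?_, fun n x => ?_, fun x => ?_, ?_⟩
  · exact (ρ n).hasCompactSupport_normed.contDiff_convolution_left _ (ρ n).contDiff_normed
      ha.continuous.locallyIntegrable
  · rw [(hfd n x).fderiv]
    calc _ ≤ ∫ t, (ρ n).normed μ t * K ∂μ := by
          refine norm_integral_le_of_norm_le ((ρ n).integrable_normed.mul_const _)
            (.of_forall fun t => ?_)
          rw [ContinuousLinearMap.lsmul_apply, norm_smul,
            Real.norm_of_nonneg ((ρ n).nonneg_normed t)]
          exact mul_le_mul_of_nonneg_left (norm_fderiv_le_of_lipschitz ℝ ha)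
            ((ρ n).nonneg_normed t)
      _ = K := by rw [integral_mul_const, (ρ n).integral_normed, one_mul]
  · refine (ρ n).dist_normed_convolution_le ha.continuous.aestronglyMeasurable fun y hy => ?_
    refine (ha.dist_le_mul y x).trans ?_
    exact mul_le_of_le_one_right K.2 ((Metric.mem_ball.1 hy).le.trans (hle n))
  · exact ContDiffBump.convolution_tendsto_right_of_continuous hout ha.continuous x
  · have h := ContDiffBump.ae_convolution_tendsto_right_of_locallyIntegrable (μ := μ) (K := 2)
      hout (.of_forall fun n => by change 1 / ((n : ℝ) + 1) ≤ 2 * (1 / ((n : ℝ) + 1) / 2); linarith)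
      ha.locallyIntegrable_fderiv
    filter_upwards [h] with x hx
    exact hx.congr fun n => (hfd n x).fderiv.symm

end Mollification

/-! ### The cross product and gradients -/

theorem cross3_apply (a b : E3) : cross3 a b =
    !₂[a 1 * b 2 - a 2 * b 1, a 2 * b 0 - a 0 * b 2, a 0 * b 1 - a 1 * b 0] := by
  simp [cross3, cross_apply]

theorem norm_cross3_le (a b : E3) : ‖cross3 a b‖ ≤ ‖a‖ * ‖b‖ := by
  refine abs_le_of_sq_le_sq' ?_ (by positivity) |>.2
  rw [mul_pow, EuclideanSpace.norm_sq_eq, EuclideanSpace.norm_sq_eq, EuclideanSpace.norm_sq_eq,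
    cross3_apply]
  simp only [Fin.sum_univ_three, Real.norm_eq_abs, sq_abs]
  simp
  nlinarith [sq_nonneg (a 0 * b 0 + a 1 * b 1 + a 2 * b 2)]

theorem continuous_cross3 : Continuous fun q : E3 × E3 => cross3 q.1 q.2 := by
  simp only [cross3_apply]
  refine (PiLp.continuous_toLp 2 _).comp (continuous_pi fun i => ?_)
  fin_cases i <;> simp <;> fun_prop

theorem tendsto_cross3 {ι : Type*} {l : Filter ι} {f g : ι → E3} {a b : E3}
    (hf : Tendsto f l (𝓝 a)) (hg : Tendsto g l (𝓝 b)) :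
    Tendsto (fun i => cross3 (f i) (g i)) l (𝓝 (cross3 a b)) := by
  have h := (continuous_cross3.tendsto (a, b)).comp (hf.prodMk_nhds hg)
  simpa only [Function.comp_def] using h

theorem gradient_apply (f : E3 → ℝ) (x : E3) (i : Fin 3) :
    gradient f x i = fderiv ℝ f x (EuclideanSpace.single i 1) := by
  rw [← inner_gradient_left, EuclideanSpace.inner_single_right]
  simp

theorem norm_gradient (f : E3 → ℝ) (x : E3) : ‖gradient f x‖ = ‖fderiv ℝ f x‖ :=
  LinearIsometryEquiv.norm_map _ _

theorem gradient_eq_zero_of_notMem_tsupport {φ : E3 → ℝ} {x : E3} (hx : x ∉ tsupport φ) :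
    gradient φ x = 0 := by
  rw [gradient, fderiv_of_notMem_tsupport ℝ hx, map_zero]

theorem measurable_gradient (f : E3 → ℝ) : Measurable (gradient f) :=
  (InnerProductSpace.toDual ℝ E3).symm.continuous.measurable.comp (measurable_fderiv ℝ f)

theorem ContDiff.continuous_gradient {f : E3 → ℝ} (hf : ContDiff ℝ ∞ f) :
    Continuous (gradient f) :=
  (InnerProductSpace.toDual ℝ E3).symm.continuous.comp (hf.continuous_fderiv (by simp))

/-! ### Integration by parts for the triple product of gradients -/

/-- A Lipschitz gradient is orthogonal to every smooth compactly supported field without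
divergence. -/
theorem LipschitzWith.integral_gradient_mul_eq_zero {K : NNReal} {b : E3 → ℝ}
    (hb : LipschitzWith K b) {W : Fin 3 → E3 → ℝ} (hW : ∀ i, ContDiff ℝ ∞ (W i))
    (hWc : ∀ i, HasCompactSupport (W i))
    (hdiv : ∀ x, ∑ i, fderiv ℝ (W i) x (EuclideanSpace.single i 1) = 0) :
    ∫ x, ∑ i, gradient b x i * W i x = 0 := by
  have hWi (i) : ∃ C, LipschitzWith C (W i) :=
    (hW i).lipschitzWith_of_hasCompactSupport (hWc i) (by simp)
  have key (i) : ∫ x, gradient b x i * W i x =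
      -∫ x, fderiv ℝ (W i) x (EuclideanSpace.single i 1) * b x := by
    obtain ⟨C, hC⟩ := hWi i
    rw [← integral_neg]
    have h := integral_lineDeriv_mul_eq (μ := volume) hb hC (hWc i) (EuclideanSpace.single i 1)
    calc _ = ∫ x, lineDeriv ℝ b x (EuclideanSpace.single i 1) * W i x := by
          refine integral_congr_ae ?_
          filter_upwards [hb.ae_differentiableAt (μ := volume)] with x hx
          rw [hx.lineDeriv_eq_fderiv, gradient_apply]
      _ = _ := by
          rw [h]
          refine integral_congr_ae (.of_forall fun x => ?_)
          simp [((hW i).differentiable (by simp) x).lineDeriv_eq_fderiv]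
  have hb' (i) : Integrable (fun x => gradient b x i * W i x) := by
    refine ((hW i).continuous.integrable_of_hasCompactSupport (hWc i)).bdd_mul (c := K)
      ?_ (.of_forall fun x => ?_)
    · exact ((EuclideanSpace.proj (𝕜 := ℝ) i).continuous.measurable.comp
        (measurable_gradient b)).aestronglyMeasurable
    · exact (PiLp.norm_apply_le _ i).trans
        ((norm_gradient b x).trans_le (norm_fderiv_le_of_lipschitz ℝ hb))
  have hb2 (i) : Integrable
      (fun x => fderiv ℝ (W i) x (EuclideanSpace.single i 1) * b x) := by
    refine Continuous.integrable_of_hasCompactSupport ?_ ?_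
    · exact (((hW i).continuous_fderiv (by simp)).clm_apply continuous_const).mul hb.continuous
    · exact ((hWc i).fderiv_apply ℝ _).mul_right
  rw [integral_finsetSum _ fun i _ => hb' i]
  simp only [key]
  rw [Finset.sum_neg_distrib, ← integral_finsetSum _ fun i _ => hb2 i]
  simp [← Finset.sum_mul, hdiv]

/-- The cross product of two smooth gradients has no divergence, as second derivatives commute. -/
theorem div_cross_gradient {g h : E3 → ℝ} (hg : ContDiff ℝ ∞ g) (hh : ContDiff ℝ ∞ h) (x : E3) :
    ∑ i, fderiv ℝ (fun y => cross3 (gradient h y) (gradient g y) i) x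
      (EuclideanSpace.single i 1) = 0 := by
  have hd {f : E3 → ℝ} (hf : ContDiff ℝ ∞ f) (i : Fin 3) :
      HasFDerivAt (fun y => fderiv ℝ f y (EuclideanSpace.single i 1))
        ((fderiv ℝ (fderiv ℝ f) x).flip (EuclideanSpace.single i 1)) x := by
    have h1 : DifferentiableAt ℝ (fderiv ℝ f) x :=
      (hf.fderiv_right (m := ∞) (by simp)).differentiable (by simp) x
    simpa using! h1.hasFDerivAt.clm_apply (hasFDerivAt_const (EuclideanSpace.single i (1 : ℝ)) x)
  have hs {f : E3 → ℝ} (hf : ContDiff ℝ ∞ f) : IsSymmSndFDerivAt ℝ f x :=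
    hf.contDiffAt.isSymmSndFDerivAt
      (by simpa using WithTop.coe_le_coe.2 (le_top (a := (2 : ℕ∞))))
  have hm (i j : Fin 3) := (((hd hh i).mul (hd hg j)).sub ((hd hh j).mul (hd hg i))).fderiv
  simp only [cross3_apply, gradient_apply, Fin.sum_univ_three]
  have e0 := congr($(hm 1 2) (EuclideanSpace.single 0 1))
  have e1 := congr($(hm 2 0) (EuclideanSpace.single 1 1))
  have e2 := congr($(hm 0 1) (EuclideanSpace.single 2 1))
  simp only [add_apply, sub_apply,
    smul_apply, ContinuousLinearMap.flip_apply, smul_eq_mul] at e0 e1 e2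
  simp [Pi.sub_def, Pi.mul_def] at e0 e1 e2 ⊢
  rw [e0, e1, e2, (hs hg) (EuclideanSpace.single 0 1) (EuclideanSpace.single 1 1),
    (hs hg) (EuclideanSpace.single 0 1) (EuclideanSpace.single 2 1),
    (hs hg) (EuclideanSpace.single 1 1) (EuclideanSpace.single 2 1),
    (hs hh) (EuclideanSpace.single 0 1) (EuclideanSpace.single 1 1),
    (hs hh) (EuclideanSpace.single 0 1) (EuclideanSpace.single 2 1),
    (hs hh) (EuclideanSpace.single 1 1) (EuclideanSpace.single 2 1)]
  ring

theorem ContDiff.fderiv_single {f : E3 → ℝ} (hf : ContDiff ℝ ∞ f) (i : Fin 3) :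
    ContDiff ℝ ∞ fun y => fderiv ℝ f y (EuclideanSpace.single i 1) :=
  (hf.fderiv_right (m := ∞) (by simp)).clm_apply contDiff_const

/-- Integration by parts for the triple product when two of the functions are smooth: the Lipschitz
gradient is tested with the divergence-free field `∇h × ∇g`. -/
theorem LipschitzWith.integral_triple_eq_zero_of_contDiff {K : NNReal} {b g h : E3 → ℝ}
    (hb : LipschitzWith K b) (hg : ContDiff ℝ ∞ g) (hgc : HasCompactSupport g)
    (hh : ContDiff ℝ ∞ h) :
    ∫ x, inner ℝ (cross3 (gradient b x) (gradient h x)) (gradient g x) = 0 := by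
  have key := hb.integral_gradient_mul_eq_zero
    (W := fun i y => cross3 (gradient h y) (gradient g y) i) (fun i => ?_) (fun i => ?_)
    (div_cross_gradient hg hh)
  · rw [← key]
    congr with x
    simp only [cross3_apply, PiLp.inner_apply, Fin.sum_univ_three]
    simp
    ring
  · have e := hg.fderiv_single
    have e' := hh.fderiv_single
    simp only [cross3_apply, gradient_apply]
    fin_cases i
    · simpa using ((e' 1).mul (e 2)).sub ((e' 2).mul (e 1))
    · simpa using ((e' 2).mul (e 0)).sub ((e' 0).mul (e 2))
    · simpa using ((e' 0).mul (e 1)).sub ((e' 1).mul (e 0))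
  · refine HasCompactSupport.intro hgc fun x hx => ?_
    simp only [cross3_apply, gradient_eq_zero_of_notMem_tsupport hx]
    fin_cases i <;> simp

/-- Integration by parts for three Lipschitz functions and a test function. Only `a` and `c` have
to be mollified, as the case of smooth `a` and `c` needs no smoothness of `b`. -/
theorem LipschitzWith.integral_triple_eq_zero {Ka Kb Kc : NNReal} {a b c φ : E3 → ℝ}
    (ha : LipschitzWith Ka a) (hb : LipschitzWith Kb b) (hc : LipschitzWith Kc c)
    (hφ : ContDiff ℝ ∞ φ) (hφc : HasCompactSupport φ) :
    ∫ x, inner ℝ (cross3 (gradient b x) (gradient c x))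
      (φ x • gradient a x + a x • gradient φ x) = 0 := by
  obtain ⟨A, hA, hAK, hAb, hAt, hAg⟩ := ha.exists_smooth_approx (μ := volume)
  obtain ⟨C, hC, hCK, -, -, hCg⟩ := hc.exists_smooth_approx (μ := volume)
  have hsmooth (n) : ∫ x, inner ℝ (cross3 (gradient b x) (gradient (C n) x))
      (φ x • gradient (A n) x + A n x • gradient φ x) = 0 := by
    rw [← hb.integral_triple_eq_zero_of_contDiff (hφ.mul (hA n)) hφc.mul_right (hC n)]
    congr with x
    rw [gradient, gradient, gradient, gradient, gradient, fderiv_fun_mul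
      (hφ.differentiable (by simp) x) ((hA n).differentiable (by simp) x)]
    simp
  have hgrad {f : E3 → ℝ} {F : ℕ → E3 → ℝ} {x : E3}
      (h : Tendsto (fun n => fderiv ℝ (F n) x) atTop (𝓝 (fderiv ℝ f x))) :
      Tendsto (fun n => gradient (F n) x) atTop (𝓝 (gradient f x)) :=
    ((InnerProductSpace.toDual ℝ E3).symm.continuous.tendsto _).comp h
  -- Only a bounded gradient of `C n` enters, so the values of `C n` need not be controlled.
  have hlim := tendsto_integral_of_dominated_convergence (μ := volume)
    (F := fun n x => inner ℝ (cross3 (gradient b x) (gradient (C n) x))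
      (φ x • gradient (A n) x + A n x • gradient φ x))
    (f := fun x => inner ℝ (cross3 (gradient b x) (gradient c x))
      (φ x • gradient a x + a x • gradient φ x))
    (fun x => (Kb * Kc) * (‖φ x‖ * Ka + (‖a x‖ + Ka) * ‖gradient φ x‖)) ?_ ?_ ?_ ?_
  · simp only [hsmooth] at hlim
    exact (tendsto_nhds_unique hlim tendsto_const_nhds)
  · intro n
    refine Measurable.aestronglyMeasurable ?_
    have m1 : Measurable fun x => cross3 (gradient b x) (gradient (C n) x) :=
      continuous_cross3.measurable.comp
        ((measurable_gradient b).prodMk (measurable_gradient (C n)))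
    exact m1.inner ((hφ.continuous.measurable.smul (measurable_gradient _)).add
      ((hA n).continuous.measurable.smul (measurable_gradient _)))
  · refine Continuous.integrable_of_hasCompactSupport ?_ ?_
    · have := hφ.continuous
      have := hφ.continuous_gradient
      have := ha.continuous
      fun_prop
    · refine HasCompactSupport.intro hφc fun x hx => ?_
      rw [gradient_eq_zero_of_notMem_tsupport hx, image_eq_zero_of_notMem_tsupport hx]
      simp
  · refine fun n => .of_forall fun x => (norm_inner_le_norm _ _).trans ?_
    gcongr
    · refine (norm_cross3_le _ _).trans ?_
      rw [norm_gradient, norm_gradient]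
      gcongr
      · exact norm_fderiv_le_of_lipschitz ℝ hb
      · exact hCK n x
    · refine (norm_add_le _ _).trans ?_
      rw [norm_smul, norm_smul, norm_gradient (A n)]
      gcongr
      · exact hAK n x
      · have h1 := norm_add_le (a x) (A n x - a x)
        rw [add_sub_cancel] at h1
        exact h1.trans (add_le_add_right (hAb n x) _)
  · filter_upwards [hAg, hCg] with x hx hx'
    have h3 : Tendsto (fun n => φ x • gradient (A n) x + A n x • gradient φ x) atTop
        (𝓝 (φ x • gradient a x + a x • gradient φ x)) :=
      ((hgrad hx).const_smul _).add ((hAt x).smul_const _)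
    exact (tendsto_cross3 tendsto_const_nhds (hgrad hx')).inner h3

/-! ### Fields with a square-integrable divergence on a domain of finite volume -/

/-- `f` is Lipschitz near each point of `Ω`, with a constant that does not depend on the point. -/
def UniformlyLocallyLipschitzOn (f : E3 → ℝ) (Ω : Set E3) : Prop :=
  ∃ K : NNReal, ∀ x ∈ Ω, ∃ s ∈ 𝓝 x, LipschitzOnWith K f s

namespace UniformlyLocallyLipschitzOn

variable {Ω : Set E3} {f : E3 → ℝ}

theorem exists_norm_gradient_le (hf : UniformlyLocallyLipschitzOn f Ω) :
    ∃ C : NNReal, ∀ x ∈ Ω, ‖gradient f x‖ ≤ C := by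
  obtain ⟨K, hK⟩ := hf
  refine ⟨K, fun x hx => ?_⟩
  obtain ⟨s, hs, h⟩ := hK x hx
  rw [norm_gradient]
  exact norm_fderiv_le_of_lipschitzOn ℝ hs h

theorem continuousOn (hf : UniformlyLocallyLipschitzOn f Ω) : ContinuousOn f Ω := by
  obtain ⟨K, hK⟩ := hf
  intro x hx
  obtain ⟨s, hs, h⟩ := hK x hx
  exact (h.continuousOn.continuousAt hs).continuousWithinAt

/-- On a compact subset of `Ω` the function agrees with a globally Lipschitz one. -/
theorem exists_lipschitzWith_eqOn (hf : UniformlyLocallyLipschitzOn f Ω) {L : Set E3}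
    (hL : IsCompact L) (hLΩ : L ⊆ Ω) :
    ∃ (K : NNReal) (g : E3 → ℝ), LipschitzWith K g ∧ EqOn f g L := by
  obtain ⟨K, hK⟩ := hf
  have h : LocallyLipschitzOn L f := fun x hx => by
    obtain ⟨s, hs, h⟩ := hK x (hLΩ hx)
    exact ⟨K, s, mem_nhdsWithin_of_mem_nhds hs, h⟩
  obtain ⟨C, hC⟩ := h.exists_lipschitzOnWith_of_compact hL
  exact ⟨C, hC.extend_real⟩

end UniformlyLocallyLipschitzOn

theorem gradient_eq_of_eqOn {f g : E3 → ℝ} {s : Set E3} {x : E3} (h : EqOn f g s)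
    (hx : x ∈ interior s) : gradient f x = gradient g x := by
  rw [gradient, gradient, (h.eventuallyEq_of_mem (mem_interior_iff_mem_nhds.1 hx)).fderiv_eq]

theorem MeasureTheory.MemLp.integrable_inner_of_two {α : Type*} [MeasurableSpace α] {μ : Measure α}
    {f g : α → E3} (hf : MemLp f 2 μ) (hg : MemLp g 2 μ) :
    Integrable (fun x => inner ℝ (f x) (g x)) μ :=
  (hf.norm.integrable_mul hg.norm).mono' (hf.1.inner hg.1)
    (.of_forall fun _ => norm_inner_le_norm _ _)

theorem memLp_gradient_of_hasCompactSupport {φ : E3 → ℝ} (hφ : ContDiff ℝ ∞ φ)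
    (hφc : HasCompactSupport φ) (Ω : Set E3) :
    MemLp (gradient φ) 2 (volume.restrict Ω) :=
  hφ.continuous_gradient.memLp_of_hasCompactSupport
    (HasCompactSupport.intro hφc fun _ hx => gradient_eq_zero_of_notMem_tsupport hx)

/-- The weak divergence of `a ∇b × ∇c` is the triple product `∇a · (∇b × ∇c)`. -/
theorem hasWeakDiv_smul_cross_gradient {Ω : Set E3} {a b c : E3 → ℝ} (hΩ : IsOpen Ω)
    (ha : UniformlyLocallyLipschitzOn a Ω) (hb : UniformlyLocallyLipschitzOn b Ω)
    (hc : UniformlyLocallyLipschitzOn c Ω)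
    (hu : MemLp (fun x => a x • cross3 (gradient b x) (gradient c x)) 2 (volume.restrict Ω))
    (hd : MemLp (fun x => inner ℝ (cross3 (gradient b x) (gradient c x)) (gradient a x)) 2
      (volume.restrict Ω)) :
    HasWeakDiv Ω (fun x => a x • cross3 (gradient b x) (gradient c x))
      (fun x => inner ℝ (cross3 (gradient b x) (gradient c x)) (gradient a x)) := by
  intro φ hφ hφc hφΩ
  obtain ⟨L, hL, hφL, hLΩ⟩ := exists_compact_between hφc hΩ hφΩ
  obtain ⟨Ka, a', ha', eqa⟩ := ha.exists_lipschitzWith_eqOn hL hLΩ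
  obtain ⟨Kb, b', hb', eqb⟩ := hb.exists_lipschitzWith_eqOn hL hLΩ
  obtain ⟨Kc, c', hc', eqc⟩ := hc.exists_lipschitzWith_eqOn hL hLΩ
  have key := ha'.integral_triple_eq_zero hb' hc' hφ hφc
  have hpt (x) : inner ℝ (cross3 (gradient b' x) (gradient c' x))
      (φ x • gradient a' x + a' x • gradient φ x) =
      inner ℝ (a x • cross3 (gradient b x) (gradient c x)) (gradient φ x) +
      inner ℝ (cross3 (gradient b x) (gradient c x)) (gradient a x) * φ x := by
    by_cases hx : x ∈ tsupport φ
    · have hxL := hφL hx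
      rw [gradient_eq_of_eqOn eqa hxL, gradient_eq_of_eqOn eqb hxL, gradient_eq_of_eqOn eqc hxL,
        eqa (interior_subset hxL), inner_add_right, inner_smul_right, inner_smul_right,
        real_inner_smul_left]
      ring
    · rw [gradient_eq_zero_of_notMem_tsupport hx, image_eq_zero_of_notMem_tsupport hx]
      simp
  have hdφ : Integrable (fun x => inner ℝ (cross3 (gradient b x) (gradient c x)) (gradient a x) *
      φ x) (volume.restrict Ω) :=
    hd.integrable_mul (q := 2) (hφ.continuous.memLp_of_hasCompactSupport hφc)
  rw [eq_neg_iff_add_eq_zero, ← integral_add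
    (hu.integrable_inner_of_two (memLp_gradient_of_hasCompactSupport hφ hφc Ω)) hdφ, ← key]
  simp only [hpt]
  refine setIntegral_eq_integral_of_forall_compl_eq_zero fun x hx => ?_
  have hx' : x ∉ tsupport φ := fun h => hx (hφΩ h)
  rw [gradient_eq_zero_of_notMem_tsupport hx', image_eq_zero_of_notMem_tsupport hx']
  simp

/-- At points where `b` or `c` is not differentiable its gradient is `0` by convention, so the bounds
on the field and on its divergence hold everywhere in `Ω`. -/
theorem smul_cross_gradient_mem_HdivSpace {Ω : Set E3} {a b c : E3 → ℝ} (hΩ : IsOpen Ω)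
    (hvol : volume Ω ≠ ⊤)
    (ha : UniformlyLocallyLipschitzOn a Ω) (hb : UniformlyLocallyLipschitzOn b Ω)
    (hc : UniformlyLocallyLipschitzOn c Ω) {A : ℝ} (hA : ∀ x ∈ Ω, |a x| ≤ A) :
    (fun x => a x • cross3 (gradient b x) (gradient c x)) ∈ HdivSpace Ω := by
  have : IsFiniteMeasure (volume.restrict Ω) := isFiniteMeasure_restrict.2 hvol
  obtain ⟨Ca, hCa⟩ := ha.exists_norm_gradient_le
  obtain ⟨Cb, hCb⟩ := hb.exists_norm_gradient_le
  obtain ⟨Cc, hCc⟩ := hc.exists_norm_gradient_le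
  have hm : Measurable fun x => cross3 (gradient b x) (gradient c x) :=
    continuous_cross3.measurable.comp ((measurable_gradient b).prodMk (measurable_gradient c))
  have hcr {x} (hx : x ∈ Ω) : ‖cross3 (gradient b x) (gradient c x)‖ ≤ Cb * Cc :=
    (norm_cross3_le _ _).trans
      (mul_le_mul (hCb x hx) (hCc x hx) (norm_nonneg _) Cb.2)
  have hu : MemLp (fun x => a x • cross3 (gradient b x) (gradient c x)) 2
      (volume.restrict Ω) := by
    refine MemLp.of_bound ((ha.continuousOn.aestronglyMeasurable hΩ.measurableSet).smul
      hm.aestronglyMeasurable) (A * (Cb * Cc)) ?_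
    refine ae_restrict_of_forall_mem hΩ.measurableSet fun x hx => ?_
    rw [norm_smul]
    exact mul_le_mul (hA x hx) (hcr hx) (norm_nonneg _) ((abs_nonneg _).trans (hA x hx))
  have hd : MemLp (fun x => inner ℝ (cross3 (gradient b x) (gradient c x)) (gradient a x)) 2
      (volume.restrict Ω) := by
    refine MemLp.of_bound (hm.inner (measurable_gradient a)).aestronglyMeasurable
      (Cb * Cc * Ca) ?_
    refine ae_restrict_of_forall_mem hΩ.measurableSet fun x hx => ?_
    exact (norm_inner_le_norm _ _).trans
      (mul_le_mul (hcr hx) (hCa x hx) (norm_nonneg _) (by positivity))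
  exact ⟨hu, _, hd, hasWeakDiv_smul_cross_gradient hΩ ha hb hc hu hd⟩

theorem zero_mem_HdivSpace (Ω : Set E3) : (0 : E3 → E3) ∈ HdivSpace Ω :=
  ⟨MemLp.zero, 0, MemLp.zero, fun φ _ _ _ => by simp⟩

theorem add_mem_HdivSpace {Ω : Set E3} {u w : E3 → E3} (hu : u ∈ HdivSpace Ω)
    (hw : w ∈ HdivSpace Ω) : u + w ∈ HdivSpace Ω := by
  obtain ⟨hu, d, hd, hud⟩ := hu
  obtain ⟨hw, e, he, hwe⟩ := hw
  refine ⟨hu.add hw, d + e, hd.add he, fun φ hφ hφc hφΩ => ?_⟩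
  have h1 := memLp_gradient_of_hasCompactSupport hφ hφc Ω
  have h2 : MemLp φ 2 (volume.restrict Ω) := hφ.continuous.memLp_of_hasCompactSupport hφc
  have h3 : Integrable (fun x => d x * φ x) (volume.restrict Ω) := hd.integrable_mul h2
  have h4 : Integrable (fun x => e x * φ x) (volume.restrict Ω) := he.integrable_mul h2
  simp only [Pi.add_apply, inner_add_left, add_mul]
  rw [integral_add (hu.integrable_inner_of_two h1) (hw.integrable_inner_of_two h1),
    integral_add h3 h4, hud φ hφ hφc hφΩ,
    hwe φ hφ hφc hφΩ, neg_add]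

theorem smul_mem_HdivSpace {Ω : Set E3} {u : E3 → E3} (r : ℝ) (hu : u ∈ HdivSpace Ω) :
    r • u ∈ HdivSpace Ω := by
  obtain ⟨hu, d, hd, hud⟩ := hu
  refine ⟨hu.const_smul r, r • d, hd.const_smul r, fun φ hφ hφc hφΩ => ?_⟩
  simp only [Pi.smul_apply, real_inner_smul_left, smul_eq_mul, mul_assoc, integral_const_mul,
    hud φ hφ hφc hφΩ, mul_neg]

/-! ### Hat functions -/

/-- On a convex set, a Lipschitz estimate near each point gives a Lipschitz estimate, by continuation
along segments. -/
theorem Convex.lipschitzOnWith_of_eventually_dist_le {E : Type*} [NormedAddCommGroup E]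
    [NormedSpace ℝ E] {s : Set E} (hs : Convex ℝ s) {K : NNReal} {f : E → ℝ}
    (hf : ∀ x ∈ s, ∀ᶠ y in 𝓝[s] x, dist (f y) (f x) ≤ K * dist y x) :
    LipschitzOnWith K f s := by
  have hcont : ContinuousOn f s := fun x hx => by
    refine tendsto_iff_dist_tendsto_zero.2 (squeeze_zero' (.of_forall fun _ => dist_nonneg)
      (hf x hx) ?_)
    have h : Tendsto (fun y => K * dist y x) (𝓝 x) (𝓝 (K * dist x x)) :=
      ((continuous_id.dist continuous_const).const_mul _).tendsto x
    rw [dist_self, mul_zero] at h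
    exact h.mono_left nhdsWithin_le_nhds
  refine LipschitzOnWith.of_dist_le_mul fun y hy x hx => ?_
  let γ : ℝ → E := AffineMap.lineMap x y
  have hγ : Continuous γ := AffineMap.lineMap_continuous
  have hγs : MapsTo γ (Icc 0 1) s := fun t ht => hs.lineMap_mem hx hy ht
  have hsub : Icc (0 : ℝ) 1 ⊆ {t | dist (f (γ t)) (f x) ≤ K * (t * dist x y)} := by
    refine IsClosed.Icc_subset_of_forall_mem_nhdsWithin ?_ ?_ ?_
    · have h := isClosed_Icc.isClosed_le (f := fun t : ℝ => dist (f (γ t)) (f x))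
        (g := fun t => K * (t * dist x y))
        (continuous_dist.comp_continuousOn
          ((hcont.comp hγ.continuousOn hγs).prodMk continuousOn_const)) (by fun_prop)
      rwa [show {t | dist (f (γ t)) (f x) ≤ K * (t * dist x y)} ∩ Icc 0 1 =
        {t ∈ Icc (0 : ℝ) 1 | dist (f (γ t)) (f x) ≤ K * (t * dist x y)} from inter_comm _ _]
    · simp [γ]
    · rintro t ⟨ht, ht01⟩
      have hlim : Tendsto γ (𝓝[>] t) (𝓝[s] (γ t)) := by
        refine tendsto_nhdsWithin_iff.2 ⟨hγ.continuousAt.mono_left nhdsWithin_le_nhds, ?_⟩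
        filter_upwards [Ioo_mem_nhdsGT ht01.2] with r hr
        exact hγs ⟨ht01.1.trans hr.1.le, hr.2.le⟩
      filter_upwards [hlim.eventually (hf _ (hγs ⟨ht01.1, ht01.2.le⟩)), self_mem_nhdsWithin]
        with r hr htr
      rw [dist_lineMap_lineMap, Real.dist_eq r t, abs_of_pos (sub_pos.2 htr)] at hr
      have := dist_triangle (f (γ r)) (f (γ t)) (f x)
      simp only [mem_ofPred_eq] at ht ⊢
      linarith
  have h := hsub (right_mem_Icc.2 zero_le_one)
  simpa [γ, dist_comm x y] using h

/-- A function that is Lipschitz on each set of a finite closed cover of an open set is uniformly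
locally Lipschitz there: a point has a neighbourhood that meets only those sets of the cover which
contain the point. -/
theorem uniformlyLocallyLipschitzOn_of_finite_closed_cover {S : Set (Set E3)} (hS : S.Finite)
    (hclosed : ∀ m ∈ S, IsClosed m) {Ω : Set E3} (hΩ : IsOpen Ω) (hcover : Ω ⊆ ⋃ m ∈ S, m)
    {f : E3 → ℝ} {K : NNReal} (hf : ∀ m ∈ S, LipschitzOnWith K f m) :
    UniformlyLocallyLipschitzOn f Ω := by
  have hpt : ∀ x ∈ Ω, ∀ᶠ y in 𝓝 x, dist (f y) (f x) ≤ K * dist y x := by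
    intro x hx
    have h1 : ∀ᶠ y in 𝓝 x, ∀ m ∈ S, y ∈ m → x ∈ m := by
      refine (eventually_all_finite hS).2 fun m hm => ?_
      by_cases hxm : x ∈ m
      · exact .of_forall fun _ _ => hxm
      · filter_upwards [(hclosed m hm).isOpen_compl.mem_nhds hxm] with y hy hym
        exact absurd hym hy
    filter_upwards [h1, hΩ.mem_nhds hx] with y hy hyΩ
    obtain ⟨m, hm, hym⟩ := mem_iUnion₂.1 (hcover hyΩ)
    exact (hf m hm).dist_le_mul y hym x (hy m hm hym)
  refine ⟨K, fun x hx => ?_⟩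
  obtain ⟨r, hr, hball⟩ := Metric.isOpen_iff.1 hΩ x hx
  exact ⟨Metric.ball x r, Metric.ball_mem_nhds x hr,
    (convex_ball x r).lipschitzOnWith_of_eventually_dist_le fun y hy =>
      nhdsWithin_le_nhds (hpt y (hball hy))⟩

namespace PolyhedralMesh

theorem isCompact_of_mem_cells (M : PolyhedralMesh) {m : Set E3} (hm : m ∈ M.cells) :
    IsCompact m := by
  obtain ⟨s, rfl⟩ := M.polytope m hm
  exact s.finite_toSet.isCompact_convexHull ℝ

theorem volume_domain_ne_top (M : PolyhedralMesh) : volume M.domain ≠ ⊤ :=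
  ((measure_mono interior_subset).trans_lt
    (M.finite_cells.isCompact_biUnion fun _ hm => M.isCompact_of_mem_cells hm).measure_lt_top).ne

end PolyhedralMesh

/-- The coordinates are non-negative and, by reproduction of the constant `1`, sum to `1`. -/
theorem IsGBC.le_one {ι : Type*} [Finite ι] {m : Set E3} {v : ι → E3} {lam : ι → E3 → ℝ}
    (h : IsGBC m v lam) (i : ι) {x : E3} (hx : x ∈ m) : lam i x ≤ 1 := by
  have := Fintype.ofFinite ι
  have e := h.reproduces (AffineMap.const ℝ E3 1) x hx
  rw [finsum_eq_sum_of_fintype] at e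
  simp only [AffineMap.const_apply, one_mul] at e
  rw [e]
  exact Finset.single_le_sum (fun j _ => h.nonneg j x hx) (Finset.mem_univ i)

theorem abs_hatFun_le_one (M : PolyhedralMesh) {p : ℕ} (v : Fin p → E3)
    (lam : Set E3 → Fin p → E3 → ℝ)
    (hgbc : ∀ m ∈ M.cells,
      IsGBC m (fun i : {i : Fin p // v i ∈ m} => v i) (fun i => lam m i))
    (i : Fin p) (x : E3) : |hatFun M v lam i x| ≤ 1 := by
  rw [hatFun]
  split_ifs with h
  · obtain ⟨hc, hxc, hic⟩ := h.choose_spec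
    rw [abs_of_nonneg ((hgbc _ hc).nonneg ⟨i, hic⟩ x hxc)]
    exact (hgbc _ hc).le_one ⟨i, hic⟩ hxc
  · simp

theorem uniformlyLocallyLipschitzOn_hatFun (M : PolyhedralMesh) {p : ℕ} (v : Fin p → E3)
    (lam : Set E3 → Fin p → E3 → ℝ)
    (hgbc : ∀ m ∈ M.cells,
      IsGBC m (fun i : {i : Fin p // v i ∈ m} => v i) (fun i => lam m i))
    (hlip : ∀ m ∈ M.cells, ∀ i, v i ∈ m → ∃ K : NNReal, LipschitzOnWith K (lam m i) m)
    (hagree : ∀ m ∈ M.cells, ∀ m' ∈ M.cells, ∀ i, v i ∈ m → v i ∈ m' →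
      Set.EqOn (lam m i) (lam m' i) (m ∩ m')) (i : Fin p) :
    UniformlyLocallyLipschitzOn (hatFun M v lam i) M.domain := by
  have hcell : ∀ m ∈ M.cells, ∃ K : NNReal, LipschitzOnWith K (hatFun M v lam i) m := by
    intro m hm
    by_cases hi : v i ∈ m
    · obtain ⟨K, hK⟩ := hlip m hm i hi
      exact ⟨K, fun x hx y hy => by
        rw [hatFun_eq M v lam hagree hm hi hx, hatFun_eq M v lam hagree hm hi hy]
        exact hK hx hy⟩
    · exact ⟨0, fun x hx y hy => by
        simp [hatFun_eq_zero M v lam hgbc hm hi hx, hatFun_eq_zero M v lam hgbc hm hi hy]⟩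
  choose! K hK using hcell
  obtain ⟨C, hC⟩ := (M.finite_cells.image K).bddAbove
  exact uniformlyLocallyLipschitzOn_of_finite_closed_cover M.finite_cells
    (fun m hm => (M.isCompact_of_mem_cells hm).isClosed) isOpen_interior interior_subset
    fun m hm => (hK m hm).weaken (hC (mem_image_of_mem K hm))

end

theorem theorem3p4 (M : PolyhedralMesh) (p : ℕ) (v : Fin p → E3)
    (hv_inj : Function.Injective v) (hv_range : Set.range v = M.vertices)
    (lam : Set E3 → Fin p → E3 → ℝ)
    (hgbc : ∀ m ∈ M.cells,
      IsGBC m (fun i : {i : Fin p // v i ∈ m} => v i) (fun i => lam m i))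
    (hlip : ∀ m ∈ M.cells, ∀ i, v i ∈ m → ∃ K : NNReal, LipschitzOnWith K (lam m i) m)
    (hagree : ∀ m ∈ M.cells, ∀ m' ∈ M.cells, ∀ i, v i ∈ m → v i ∈ m' →
      Set.EqOn (lam m i) (lam m' i) (m ∩ m'))
    (u : E3 → E3)
    (hu : u ∈ Submodule.span ℝ {f : E3 → E3 | ∃ i j k : Fin p,
      (∃ m ∈ M.cells, v i ∈ m ∧ v j ∈ m ∧ v k ∈ m) ∧ f = hatField M v lam i j k}) :
    u ∈ HdivSpace M.domain := by
  have hL := uniformlyLocallyLipschitzOn_hatFun M v lam hgbc hlip hagree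
  refine Submodule.span_induction (p := fun w _ => w ∈ HdivSpace M.domain) ?_
    (zero_mem_HdivSpace _) (fun _ _ _ _ => add_mem_HdivSpace)
    (fun r _ _ => smul_mem_HdivSpace r) hu
  rintro _ ⟨i, j, k, -, rfl⟩
  exact smul_cross_gradient_mem_HdivSpace isOpen_interior M.volume_domain_ne_top (hL i) (hL j)
    (hL k) fun x _ => abs_hatFun_le_one M v lam hgbc i x
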